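/- Let $K$ be an infinite field of characteristic different from $2$, let $k\ge 2$, $n\ge k$ and $s\ge 1$ be integers, and let $Gr(k,n)\subset\mathbb P^N$, $N=\binom{n+1}{k+1}-1$, be the Grassmannian of projective $k$-planes in $\mathbb P^n$ over $K$ (equivalently, of $(k+1)$-dimensional subspaces of $K^{n+1}$) in its Plücker embedding. Let the $s$-secant variety $\sigma_s(Gr(k,n))\subseteq\mathbb P^N$ be the Zariski closure of the union of the linear spans $\langle Q_1,\dots,Q_s\rangle$ over all $s$-tuples of points $Q_1,\dots,Q_s\in Gr(k,n)$. The dimension of a nonempty subset of $\mathbb P^N$ is understood as the Krull dimension of its homogeneous coordinate ring minus $1$. If $3(s-1)\le n-k$, then $$\dim\sigma_s(Gr(k,n))=s\bigl[(k+1)(n-k)+1\bigr]-1 .$$ In particular $\sigma_s(Gr(k,n))$ has the expected dimension $\min\{s(d+1)-1,\,N\}$, where $d=\dim Gr(k,n)=(k+1)(n-k)$. -/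

import Mathlib

namespace SecantGrassmannian

section Projective

variable {K : Type*} [Field K] {ι : Type*}

/-- The polynomial `f` vanishes at the point `p` of projective space, i.e. on the whole line `p`.
For a homogeneous polynomial this is the usual vanishing at one (equivalently, at every) vector of
homogeneous coordinates of `p`. -/
def VanishesAt (f : MvPolynomial ι K) (p : Projectivization K (ι → K)) : Prop :=
  ∀ v ∈ p.submodule, MvPolynomial.eval v f = 0

/-- The homogeneous polynomials that vanish on a subset of projective space. -/
def vanishingForms (X : Set (Projectivization K (ι → K))) : Set (MvPolynomial ι K) :=
  {f | (∃ d, f.IsHomogeneous d) ∧ ∀ p ∈ X, VanishesAt f p}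

/-- The homogeneous ideal of a subset of projective space. -/
noncomputable def homogeneousIdeal (X : Set (Projectivization K (ι → K))) : Ideal (MvPolynomial ι K) :=
  Ideal.span (vanishingForms X)

/-- The Zariski closure of a subset of projective space. -/
def zariskiClosure (X : Set (Projectivization K (ι → K))) : Set (Projectivization K (ι → K)) :=
  {p | ∀ f ∈ vanishingForms X, VanishesAt f p}

/-- The homogeneous coordinate ring of a subset of projective space. -/
abbrev HomogeneousCoordinateRing (X : Set (Projectivization K (ι → K))) : Type _ :=
  MvPolynomial ι K ⧸ homogeneousIdeal X

/-- `X` has dimension `d` as a projective algebraic set: its affine cone has dimension `d + 1`,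
i.e. the homogeneous coordinate ring of `X` has Krull dimension `d + 1`. (The empty set has no
dimension, since its homogeneous coordinate ring is the zero ring.) -/
def HasDimension (X : Set (Projectivization K (ι → K))) (d : ℕ) : Prop :=
  ringKrullDim (HomogeneousCoordinateRing X) = ((d + 1 : ℕ) : WithBot ℕ∞)

/-- The linear span of an `s`-tuple of points of projective space. -/
def linearSpan {s : ℕ} (Q : Fin s → Projectivization K (ι → K)) :
    Set (Projectivization K (ι → K)) :=
  {p | p.submodule ≤ ⨆ i, (Q i).submodule}

/-- The `s`-secant variety: the Zariski closure of the union of the linear spans of all `s`-tuples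
of points of `X`. -/
def secantVariety (s : ℕ) (X : Set (Projectivization K (ι → K))) :
    Set (Projectivization K (ι → K)) :=
  zariskiClosure {p | ∃ Q : Fin s → Projectivization K (ι → K), (∀ i, Q i ∈ X) ∧ p ∈ linearSpan Q}

/-- The `s`-secant variety of `X`, where `X` has dimension `d` in the projective space of dimension
`m = |ι| - 1`, has the expected dimension `min {s (d + 1) - 1, m}`. -/
def HasExpectedDimension [Fintype ι] (s : ℕ) (X : Set (Projectivization K (ι → K))) : Prop :=
  ∃ d : ℕ, HasDimension X d ∧
    HasDimension (secantVariety s X) (min (s * (d + 1) - 1) (Fintype.card ι - 1))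

end Projective

/-- The index set of the Plücker coordinates: the `(k+1)`-element subsets of `{0, …, n}`, written
as increasing sequences `i₀ < ⋯ < iₖ`. -/
abbrev PluckerIndex (k n : ℕ) : Type := Fin (k + 1) ↪o Fin (n + 1)

/-- The Plücker coordinates of `v₀ ∧ ⋯ ∧ vₖ`, where `v₀, …, vₖ` are the rows of `A`: the maximal
minors of `A`. -/
def pluckerVector {K : Type*} [Field K] {k n : ℕ} (A : Matrix (Fin (k + 1)) (Fin (n + 1)) K) :
    PluckerIndex k n → K :=
  fun I => (A.submatrix id I).det

/-- The Grassmannian `Gr(k, n)` of projective `k`-planes in `ℙⁿ` over `K`, i.e. of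
`(k+1)`-dimensional subspaces `W` of `K^{n+1}`, in its Plücker embedding. The subspace `W` is given
by a basis, the rows of `A`. -/
def grassmannian (K : Type*) [Field K] (k n : ℕ) :
    Set (Projectivization K (PluckerIndex k n → K)) :=
  {p | ∃ A : Matrix (Fin (k + 1)) (Fin (n + 1)) K,
    LinearIndependent K A.row ∧ p.submodule = Submodule.span K {pluckerVector A}}

end SecantGrassmannian

open MvPolynomial

theorem ringKrullDim_eq_of_isIntegral_of_injective {A B : Type*} [CommRing A] [CommRing B]
    [Algebra A B] [Algebra.IsIntegral A B]
    (hinj : Function.Injective (algebraMap A B)) : ringKrullDim B = ringKrullDim A := by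
  apply le_antisymm
  · refine Order.krullDim_le_of_strictMono (PrimeSpectrum.comap (algebraMap A B)) fun p q hpq => ?_
    exact Ideal.IsIntegral.comap_lt_comap (R := A) (I := p.asIdeal) (J := q.asIdeal) hpq
  · refine iSup_le fun l => ?_
    obtain ⟨P, -, hP, hPl⟩ := Ideal.exists_ideal_over_prime_of_isIntegral
      (RelSeries.head l).asIdeal (⊥ : Ideal B)
      (by rw [← RingHom.ker_eq_comap_bot, (RingHom.injective_iff_ker_eq_bot _).1 hinj]; exact bot_le)
    have : P.LiesOver (RelSeries.head l).asIdeal := ⟨hPl.symm⟩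
    obtain ⟨L, hL, -⟩ := Ideal.exists_ltSeries_of_hasGoingUp l P
    rw [← hL]
    exact Order.LTSeries.length_le_krullDim L

/-- A finitely generated domain over a field has Krull dimension `|V|` as soon as it embeds into the
polynomial ring in the variables `V` and contains a `V`-indexed algebraically independent family. -/
theorem ringKrullDim_eq_card_of_algebraicIndependent {K : Type*} [Field K] {V : Type*} [Finite V]
    {B : Type*} [CommRing B] [IsDomain B] [Algebra K B] [Algebra.FiniteType K B]
    (j : B →ₐ[K] MvPolynomial V K) (hj : Function.Injective j)
    (x : V → B) (hx : AlgebraicIndependent K x) : ringKrullDim B = (Nat.card V : WithBot ℕ∞) := by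
  have htb : IsTranscendenceBasis K (fun v => j (x v)) :=
    (hx.map' hj).isTranscendenceBasis_of_lift_trdeg_le_of_finite (by simp)
  have hxb : IsTranscendenceBasis K x := IsTranscendenceBasis.of_comp j hj htb
  obtain ⟨r, g, hg, hgi⟩ := exists_integral_inj_algHom_of_fg K B
  algebraize [g.toRingHom]
  have : Algebra.IsIntegral (MvPolynomial (Fin r) K) B := ⟨hgi⟩
  have hy : IsTranscendenceBasis K (algebraMap (MvPolynomial (Fin r) K) B ∘ X) := by
    have : FaithfulSMul (MvPolynomial (Fin r) K) B :=
      (faithfulSMul_iff_algebraMap_injective _ _).2 hg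
    exact (IsTranscendenceBasis.mvPolynomial (Fin r) K).algebraMap_comp
  have hcard := IsTranscendenceBasis.lift_cardinalMk_eq hxb hy
  rw [ringKrullDim_eq_of_isIntegral_of_injective (A := MvPolynomial (Fin r) K) (B := B) hg,
    MvPolynomial.ringKrullDim_of_isNoetherianRing, ringKrullDim_eq_zero_of_field, zero_add]
  have : Nat.card V = Nat.card (Fin r) := by
    have := congrArg Cardinal.toNat hcard
    simpa [Nat.card] using this
  rw [this]

/-- A family that is algebraically independent to first order at `t = 0` is algebraically
independent. -/
theorem algebraicIndependent_C_add_X_mul {K : Type*} [Field K] {R : Type*} [CommRing R] [IsDomain R]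
    [Algebra K R] {ι : Type*} (c : ι → K) (g : ι → Polynomial R)
    (hg : AlgebraicIndependent K fun i => (g i).eval 0) :
    AlgebraicIndependent K
      (fun i => algebraMap K (Polynomial R) (c i) + Polynomial.X * g i) := by
  classical
  rw [algebraicIndependent_iff]
  intro F hF
  set T : MvPolynomial ι K →ₐ[K] MvPolynomial ι K := aeval fun i => C (c i) + X i with hT
  have hTinj : Function.Injective T := by
    refine Function.LeftInverse.injective
      (g := (aeval fun i => X i - C (c i) : MvPolynomial ι K →ₐ[K] MvPolynomial ι K)) fun p => ?_
    have : ((aeval fun i => X i - C (c i) : MvPolynomial ι K →ₐ[K] MvPolynomial ι K)).comp T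
        = AlgHom.id K _ := by
      ext i
      simp [hT, MvPolynomial.algebraMap_eq]
    exact DFunLike.congr_fun this p
  set G := T F with hG
  have hGF : aeval (fun i => Polynomial.X * g i) G = 0 := by
    rw [← hF, hG, hT, ← AlgHom.comp_apply]
    congr 1
    ext i
    simp
  suffices G = 0 from hTinj (by rw [← hG, this, map_zero])
  by_contra hne
  have hex : ∃ d, homogeneousComponent d G ≠ 0 := by
    by_contra! h
    exact hne (by rw [← sum_homogeneousComponent G]; simp [h])
  set d := Nat.find hex
  have hmin : ∀ m < d, homogeneousComponent m G = 0 := fun m hm => by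
    simpa using Nat.find_min hex hm
  have hhom : ∀ m, aeval (fun i => Polynomial.X * g i) (homogeneousComponent m G)
      = Polynomial.X ^ m * aeval g (homogeneousComponent m G) := fun m => by
    rw [MvPolynomial.aeval_def, MvPolynomial.aeval_def, eval₂_eq, eval₂_eq, Finset.mul_sum]
    refine Finset.sum_congr rfl fun e he => ?_
    have hdeg := (homogeneousComponent_isHomogeneous m G).degree_eq_sum_deg_support he
    simp_rw [mul_pow, Finset.prod_mul_distrib, Finset.prod_pow_eq_pow_sum]
    rw [show ∑ i ∈ e.support, e i = m from hdeg.symm]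
    ring
  have hsum : ∑ m ∈ Finset.range (G.totalDegree + 1),
      Polynomial.X ^ m * aeval g (homogeneousComponent m G) = 0 := by
    rw [← hGF]
    conv_rhs => rw [← sum_homogeneousComponent G, map_sum]
    exact Finset.sum_congr rfl fun m _ => (hhom m).symm
  have hdmem : d ∈ Finset.range (G.totalDegree + 1) := by
    rw [Finset.mem_range, Nat.lt_succ_iff]
    by_contra! h
    exact Nat.find_spec hex (homogeneousComponent_eq_zero _ _ h)
  have hdvd : (Polynomial.X : Polynomial R) ^ d * Polynomial.X ∣
      Polynomial.X ^ d * aeval g (homogeneousComponent d G) := by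
    rw [← Finset.add_sum_erase _ _ hdmem] at hsum
    rw [eq_neg_of_add_eq_zero_left hsum, ← pow_succ]
    refine (dvd_neg.2 (Finset.dvd_sum fun m hm => ?_))
    rcases lt_trichotomy m d with h | h | h
    · simp [hmin m h]
    · exact absurd h (Finset.ne_of_mem_erase hm)
    · exact Dvd.dvd.mul_right (pow_dvd_pow _ h) _
  have h0 := (mul_dvd_mul_iff_left (pow_ne_zero _ Polynomial.X_ne_zero)).1 hdvd
  have h1 : aeval (fun i => (g i).eval 0) (homogeneousComponent d G) = 0 := by
    rw [Polynomial.X_dvd_iff, Polynomial.coeff_zero_eq_eval_zero] at h0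
    refine Eq.trans ?_ h0
    have : ((Polynomial.aeval (0 : R)).restrictScalars K).comp (aeval g) =
        (aeval fun i => (g i).eval 0 : MvPolynomial ι K →ₐ[K] R) := by
      ext i
      simp [Polynomial.coe_aeval_eq_eval]
    rw [← this]
    simp [Polynomial.coe_aeval_eq_eval]
  exact Nat.find_spec hex ((algebraicIndependent_iff.1 hg) _ h1)

namespace SecantGrassmannian

section Cone

variable {K : Type*} [Field K] {ι : Type*}

/-- The affine cone over a subset of projective space. -/
def affineCone (X : Set (Projectivization K (ι → K))) : Set (ι → K) :=
  {v | ∃ p ∈ X, v ∈ p.submodule}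

theorem smul_mem_affineCone {X : Set (Projectivization K (ι → K))} {v : ι → K}
    (hv : v ∈ affineCone X) (c : K) : c • v ∈ affineCone X :=
  let ⟨p, hp, h⟩ := hv
  ⟨p, hp, p.submodule.smul_mem c h⟩

theorem mem_vanishingForms_iff {X : Set (Projectivization K (ι → K))} {f : MvPolynomial ι K} :
    f ∈ vanishingForms X ↔ (∃ d, f.IsHomogeneous d) ∧ ∀ v ∈ affineCone X, eval v f = 0 := by
  refine and_congr_right fun _ => ⟨?_, fun h p hp v hv => h v ⟨p, hp, hv⟩⟩
  rintro h v ⟨p, hp, hv⟩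
  exact h p hp v hv

theorem eval_smul_eq_sum (f : MvPolynomial ι K) (c : K) (v : ι → K) :
    eval (c • v) f = ∑ m ∈ Finset.range (f.totalDegree + 1),
      c ^ m * eval v (homogeneousComponent m f) := by
  conv_lhs => rw [← sum_homogeneousComponent f, map_sum]
  refine Finset.sum_congr rfl fun m _ => ?_
  rw [eval_eq, eval_eq, Finset.mul_sum]
  refine Finset.sum_congr rfl fun e he => ?_
  have hdeg := (homogeneousComponent_isHomogeneous m f).degree_eq_sum_deg_support he
  simp_rw [Pi.smul_apply, smul_eq_mul, mul_pow, Finset.prod_mul_distrib,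
    Finset.prod_pow_eq_pow_sum]
  rw [show ∑ i ∈ e.support, e i = m from hdeg.symm]
  ring

theorem mem_homogeneousIdeal_iff [Infinite K] {X : Set (Projectivization K (ι → K))}
    {f : MvPolynomial ι K} : f ∈ homogeneousIdeal X ↔ ∀ v ∈ affineCone X, eval v f = 0 := by
  refine ⟨fun hf v hv => ?_, fun hf => ?_⟩
  · have : homogeneousIdeal X ≤ RingHom.ker (eval v) :=
      Ideal.span_le.2 fun g hg => (mem_vanishingForms_iff.1 hg).2 v hv
    exact this hf
  · rw [← sum_homogeneousComponent f]
    refine Ideal.sum_mem _ fun m hm => Ideal.subset_span (mem_vanishingForms_iff.2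
      ⟨⟨m, homogeneousComponent_isHomogeneous m f⟩, fun v hv => ?_⟩)
    set P : Polynomial K := ∑ m ∈ Finset.range (f.totalDegree + 1),
      Polynomial.C (eval v (homogeneousComponent m f)) * Polynomial.X ^ m with hP
    have h0 : P = 0 := Polynomial.funext fun c => by
      rw [Polynomial.eval_zero, ← hf _ (smul_mem_affineCone hv c), eval_smul_eq_sum, hP,
        Polynomial.eval_finsetSum]
      refine Finset.sum_congr rfl fun i _ => ?_
      rw [Polynomial.eval_mul, Polynomial.eval_C, Polynomial.eval_pow, Polynomial.eval_X, mul_comm]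
    have := congrArg (fun p => p.coeff m) h0
    simpa [hP, Polynomial.finsetSum_coeff, Polynomial.coeff_C_mul, Polynomial.coeff_X_pow,
      Finset.mem_range.1 hm, Nat.lt_succ_iff, homogeneousComponent_eq_zero] using this

theorem vanishingForms_zariskiClosure (X : Set (Projectivization K (ι → K))) :
    vanishingForms (zariskiClosure X) = vanishingForms X := by
  ext f
  refine ⟨fun hf => ⟨hf.1, fun p hp => hf.2 p fun g hg => hg.2 p hp⟩,
    fun hf => ⟨hf.1, fun p hp => hp f hf⟩⟩

theorem homogeneousIdeal_zariskiClosure (X : Set (Projectivization K (ι → K))) :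
    homogeneousIdeal (zariskiClosure X) = homogeneousIdeal X := by
  rw [homogeneousIdeal, vanishingForms_zariskiClosure, homogeneousIdeal]

/-- The union of the linear spans of the `s`-tuples of points of a set. -/
def spanUnion (s : ℕ) (X : Set (Projectivization K (ι → K))) :
    Set (Projectivization K (ι → K)) :=
  {p | ∃ Q : Fin s → Projectivization K (ι → K), (∀ i, Q i ∈ X) ∧ p ∈ linearSpan Q}

theorem spanUnion_one (X : Set (Projectivization K (ι → K))) : spanUnion 1 X = X := by
  ext p
  constructor
  · rintro ⟨Q, hQ, hp⟩
    have hle : p.submodule ≤ (Q 0).submodule := by simpa [linearSpan] using hp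
    have : p.submodule = (Q 0).submodule :=
      Submodule.eq_of_le_of_finrank_eq hle (by rw [p.finrank_submodule, (Q 0).finrank_submodule])
    rw [Projectivization.submodule_injective this]
    exact hQ 0
  · intro hp
    exact ⟨fun _ => p, fun _ => hp, by simp [linearSpan]⟩

theorem affineCone_spanUnion {s : ℕ} (hs : 0 < s) {X : Set (Projectivization K (ι → K))} :
    affineCone (spanUnion s X) = {v | ∃ w : Fin s → ι → K, (∀ i, w i ∈ affineCone X) ∧
      v = ∑ i, w i} := by
  ext v
  constructor
  · rintro ⟨p, ⟨Q, hQ, hp⟩, hv⟩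
    obtain ⟨w, hw⟩ := (Submodule.mem_iSup_iff_exists_finsupp _ _).1 (hp hv)
    refine ⟨w, fun i => ⟨Q i, hQ i, hw.1 i⟩, ?_⟩
    rw [← hw.2, Finsupp.sum_fintype _ _ fun _ => rfl]
  · rintro ⟨w, hw, rfl⟩
    choose Q hQ hwQ using hw
    have hmem : ∑ i, w i ∈ ⨆ i, (Q i).submodule :=
      Submodule.sum_mem _ fun i _ => Submodule.mem_iSup_of_mem i (hwQ i)
    by_cases h0 : ∑ i, w i = 0
    · exact ⟨Q ⟨0, hs⟩, ⟨Q, hQ, le_iSup (fun i => (Q i).submodule) _⟩, by rw [h0]; exact zero_mem _⟩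
    · refine ⟨Projectivization.mk K _ h0, ⟨Q, hQ, ?_⟩, ?_⟩
      · simpa [linearSpan, Projectivization.submodule_mk] using hmem
      · simp [Projectivization.submodule_mk, Submodule.mem_span_singleton_self]

end Cone

section Chart

variable {k n : ℕ} {R R' : Type*} [CommRing R] [CommRing R']

/-- The matrix with the unit vectors in the columns `S 0, …, S k` and the columns of `B` elsewhere. -/
def chartMatrix (S : PluckerIndex k n) (B : Fin (k + 1) → Fin (n + 1) → R) :
    Matrix (Fin (k + 1)) (Fin (n + 1)) R :=
  Matrix.of fun a b => if S a = b then 1 else if b ∈ Set.range S then 0 else B a b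

theorem chartMatrix_apply_mem (S : PluckerIndex k n) (B : Fin (k + 1) → Fin (n + 1) → R)
    (a c : Fin (k + 1)) :
    chartMatrix S B a (S c) = (1 : Matrix (Fin (k + 1)) (Fin (k + 1)) R) a c := by
  simp [chartMatrix, Matrix.one_apply]

theorem chartMatrix_apply_of_notMem (S : PluckerIndex k n) (B : Fin (k + 1) → Fin (n + 1) → R)
    (a : Fin (k + 1)) {b : Fin (n + 1)} (hb : b ∉ Set.range S) : chartMatrix S B a b = B a b := by
  have hne : S a ≠ b := fun h => hb ⟨a, h⟩
  rw [chartMatrix, Matrix.of_apply, if_neg hne, if_neg hb]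

theorem chartMatrix_submatrix_self (S : PluckerIndex k n) (B : Fin (k + 1) → Fin (n + 1) → R) :
    (chartMatrix S B).submatrix id S = 1 := by
  ext a b
  exact chartMatrix_apply_mem S B a b

theorem det_chartMatrix_submatrix_update (S : PluckerIndex k n)
    (B : Fin (k + 1) → Fin (n + 1) → R) (a : Fin (k + 1)) {b : Fin (n + 1)}
    (hb : b ∉ Set.range S) :
    ((chartMatrix S B).submatrix id (Function.update S a b)).det = B a b := by
  have : (chartMatrix S B).submatrix id (Function.update S a b) =
      (1 : Matrix (Fin (k + 1)) (Fin (k + 1)) R).updateCol a fun c => B c b := by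
    ext c d
    rcases eq_or_ne d a with rfl | hd
    · simp [chartMatrix_apply_of_notMem S B c hb]
    · simp [Matrix.updateCol_ne hd, Function.update_of_ne hd, chartMatrix_apply_mem]
  rw [this, ← Matrix.cramer_apply, Matrix.cramer_one]
  rfl

/-- The number of values of `f` outside the range of `S`. -/
def offCount (S : PluckerIndex k n) (f : Fin (k + 1) → Fin (n + 1)) : ℕ :=
  (Finset.univ.filter fun p => f p ∉ Set.range S).card

theorem det_chartMatrix_smul_submatrix (S : PluckerIndex k n) (t : R)
    (B : Fin (k + 1) → Fin (n + 1) → R) (f : Fin (k + 1) → Fin (n + 1)) :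
    ((chartMatrix S (t • B)).submatrix id f).det =
      t ^ offCount S f * ((chartMatrix S B).submatrix id f).det := by
  have : (chartMatrix S (t • B)).submatrix id f = Matrix.of fun a p =>
      (fun q => if f q ∉ Set.range S then t else 1) p * (chartMatrix S B).submatrix id f a p := by
    ext a p
    change chartMatrix S (t • B) a (f p) =
      (if f p ∉ Set.range S then t else 1) * chartMatrix S B a (f p)
    by_cases hp : f p ∈ Set.range S
    · obtain ⟨c, hc⟩ := hp
      rw [if_neg (not_not.2 ⟨c, hc⟩), one_mul, ← hc, chartMatrix_apply_mem, chartMatrix_apply_mem]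
    · rw [if_pos hp, chartMatrix_apply_of_notMem S _ a hp, chartMatrix_apply_of_notMem S _ a hp]
      rfl
  rw [this, Matrix.det_mul_row (fun q => if f q ∉ Set.range S then t else 1),
    Finset.prod_ite, Finset.prod_const_one, mul_one, Finset.prod_const, offCount]

theorem map_det_chartMatrix_submatrix (h : R →+* R') (S : PluckerIndex k n)
    (B : Fin (k + 1) → Fin (n + 1) → R) (f : Fin (k + 1) → Fin (n + 1)) :
    h ((chartMatrix S B).submatrix id f).det =
      ((chartMatrix S fun a b => h (B a b)).submatrix id f).det := by
  rw [RingHom.map_det]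
  congr 1
  ext a p
  simp only [chartMatrix, RingHom.mapMatrix_apply, Matrix.map_apply, Matrix.submatrix_apply,
    Matrix.of_apply]
  split_ifs <;> simp

variable {s : ℕ}

/-- The parameters of a point of the `s`-secant variety in the charts `S 0, …, S (s - 1)`: a scalar
and the free matrix entries for each of the `s` charts. -/
abbrev ChartIndex (S : Fin s → PluckerIndex k n) : Type :=
  Σ i : Fin s, Option (Fin (k + 1) × {b : Fin (n + 1) // b ∉ Set.range (S i)})

/-- The matrix entries of the `i`-th chart. -/
def chartEntries (S : Fin s → PluckerIndex k n) (u : ChartIndex S → R) (i : Fin s) :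
    Fin (k + 1) → Fin (n + 1) → R :=
  fun a b => if h : b ∈ Set.range (S i) then 0 else u ⟨i, some (a, ⟨b, h⟩)⟩

/-- The coordinate at `f` of the point with parameters `u`. -/
def secantCoord (S : Fin s → PluckerIndex k n) (u : ChartIndex S → R)
    (f : Fin (k + 1) → Fin (n + 1)) : R :=
  ∑ i, u ⟨i, none⟩ * ((chartMatrix (S i) (chartEntries S u i)).submatrix id f).det

theorem map_secantCoord (h : R →+* R') (S : Fin s → PluckerIndex k n) (u : ChartIndex S → R)
    (f : Fin (k + 1) → Fin (n + 1)) :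
    h (secantCoord S u f) = secantCoord S (fun x => h (u x)) f := by
  rw [secantCoord, map_sum, secantCoord]
  refine Finset.sum_congr rfl fun i _ => ?_
  rw [map_mul, map_det_chartMatrix_submatrix]
  congr 5
  ext a b
  simp only [chartEntries]
  split_ifs <;> simp

end Chart

section SecantIdeal

variable {K : Type*} [Field K] {k n s : ℕ}

theorem linearIndependent_row_of_pluckerVector_ne_zero
    {A : Matrix (Fin (k + 1)) (Fin (n + 1)) K} (hA : pluckerVector A ≠ 0) :
    LinearIndependent K A.row := by
  obtain ⟨J, hJ⟩ := Function.ne_iff.1 hA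
  exact LinearIndependent.of_comp (LinearMap.funLeft K K J)
    (Matrix.linearIndependent_rows_of_det_ne_zero hJ)

theorem smul_pluckerVector_mem_affineCone {A : Matrix (Fin (k + 1)) (Fin (n + 1)) K}
    (hA : pluckerVector A ≠ 0) (c : K) :
    c • pluckerVector A ∈ affineCone (grassmannian K k n) := by
  have hmem : pluckerVector A ∈ (Projectivization.mk K _ hA).submodule := by
    rw [Projectivization.submodule_mk]
    exact Submodule.mem_span_singleton_self _
  exact smul_mem_affineCone (X := grassmannian K k n) ⟨Projectivization.mk K _ hA,
    ⟨A, linearIndependent_row_of_pluckerVector_ne_zero hA, Projectivization.submodule_mk _ _⟩,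
    hmem⟩ c

theorem exists_eq_smul_pluckerVector {v : PluckerIndex k n → K}
    (hv : v ∈ affineCone (grassmannian K k n)) :
    ∃ (c : K) (A : Matrix (Fin (k + 1)) (Fin (n + 1)) K), v = c • pluckerVector A := by
  obtain ⟨p, ⟨A, -, hp⟩, hv⟩ := hv
  rw [hp] at hv
  obtain ⟨c, hc⟩ := Submodule.mem_span_singleton.1 hv
  exact ⟨c, A, hc.symm⟩

/-- The comorphism of the parametrization of the `s`-secant variety by the charts `S`. -/
noncomputable def secantComorphism (K : Type*) [Field K] (S : Fin s → PluckerIndex k n) :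
    MvPolynomial (PluckerIndex k n) K →ₐ[K] MvPolynomial (ChartIndex S) K :=
  aeval fun J : PluckerIndex k n =>
    secantCoord S (X : ChartIndex S → MvPolynomial (ChartIndex S) K) J

theorem eval_secantComorphism (S : Fin s → PluckerIndex k n) (u : ChartIndex S → K)
    (f : MvPolynomial (PluckerIndex k n) K) :
    eval u (secantComorphism K S f) = eval (fun J : PluckerIndex k n => secantCoord S u J) f := by
  have : (aeval u : MvPolynomial (ChartIndex S) K →ₐ[K] K).comp (secantComorphism K S) =
      aeval fun J : PluckerIndex k n => secantCoord S u J := by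
    ext J
    simp only [secantComorphism, AlgHom.comp_apply, aeval_X]
    exact (map_secantCoord (aeval u : MvPolynomial (ChartIndex S) K →ₐ[K] K).toRingHom S X J).trans
        (by simp)
  exact DFunLike.congr_fun this f

theorem exists_secantCoord_eq (S : Fin s → PluckerIndex k n) (c : Fin s → K)
    (A : Fin s → Matrix (Fin (k + 1)) (Fin (n + 1)) K)
    (hA : ∀ i, ((A i).submatrix id (S i)).det ≠ 0) :
    ∃ u : ChartIndex S → K, ∀ f,
      secantCoord S u f = ∑ i, c i * ((A i).submatrix id f).det := by
  set G : Fin s → Matrix (Fin (k + 1)) (Fin (k + 1)) K := fun i => (A i).submatrix id (S i)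
  set u : ChartIndex S → K := fun x => match x with
    | ⟨i, none⟩ => c i * (G i).det
    | ⟨i, some (a, b)⟩ => ((G i)⁻¹ * A i) a b
  refine ⟨u, fun f => Finset.sum_congr rfl fun i _ => ?_⟩
  have hunit : IsUnit (G i).det := isUnit_iff_ne_zero.2 (hA i)
  have hchart : chartMatrix (S i) (chartEntries S u i) = (G i)⁻¹ * A i := by
    ext a b
    by_cases hb : b ∈ Set.range (S i)
    · obtain ⟨d, rfl⟩ := hb
      have h1 : ((G i)⁻¹ * A i) a (S i d) = ((G i)⁻¹ * G i) a d := rfl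
      rw [h1, Matrix.nonsing_inv_mul _ hunit]
      exact chartMatrix_apply_mem _ _ _ _
    · rw [chartMatrix_apply_of_notMem _ _ _ hb, chartEntries, dif_neg hb]
  have hmul : (A i).submatrix id f = G i * ((G i)⁻¹ * A i).submatrix id f := by
    have : (A i).submatrix id f = (G i * ((G i)⁻¹ * A i)).submatrix id f := by
      rw [Matrix.mul_nonsing_inv_cancel_left _ _ hunit]
    rw [this]
    rfl
  rw [hchart, hmul, Matrix.det_mul, ← mul_assoc]

theorem eval_sum_pluckerVector_eq_zero [Infinite K] (S : Fin s → PluckerIndex k n) (c : Fin s → K)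
    (A : Fin s → Matrix (Fin (k + 1)) (Fin (n + 1)) K) {f : MvPolynomial (PluckerIndex k n) K}
    (hf : secantComorphism K S f = 0) :
    eval (∑ i, c i • pluckerVector (A i) : PluckerIndex k n → K) f = 0 := by
  set E : Fin s → Matrix (Fin (k + 1)) (Fin (n + 1)) K := fun i =>
    Matrix.of fun a b => if S i a = b then 1 else 0 with hE
  set M : Fin s → Matrix (Fin (k + 1)) (Fin (n + 1)) (Polynomial K) := fun i =>
    Matrix.of fun a b => Polynomial.C (A i a b) + Polynomial.X * Polynomial.C (E i a b) with hM
  have hdet : ∀ (i) (t : K) (J : Fin (k + 1) → Fin (n + 1)),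
      ((M i).submatrix id J).det.eval t = ((A i + t • E i).submatrix id J).det := by
    intro i t J
    rw [← Polynomial.coe_evalRingHom, RingHom.map_det]
    congr 1
    ext a b
    simpa [hM] using mul_comm _ _
  have hD : ∀ i, ((M i).submatrix id (S i)).det ≠ 0 := by
    intro i
    have : ((M i).submatrix id (S i)).det = (-((A i).submatrix id (S i))).charpoly := by
      rw [Matrix.charpoly]
      congr 1
      ext a b : 2
      by_cases h : a = b
      · subst h
        simp [hM, hE, add_comm]
      · simp [hM, hE, h]
    rw [this]
    exact (Matrix.charpoly_monic _).ne_zero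
  set P : Polynomial K := aeval (fun J : PluckerIndex k n =>
    ∑ i, Polynomial.C (c i) * ((M i).submatrix id J).det) f with hP
  have hPeval : ∀ t, P.eval t = eval (∑ i, c i • pluckerVector (A i + t • E i)) f := by
    intro t
    have : (Polynomial.aeval t).comp (aeval (fun J : PluckerIndex k n =>
        ∑ i, Polynomial.C (c i) * ((M i).submatrix id J).det)) =
        aeval (∑ i, c i • pluckerVector (A i + t • E i)) := by
      ext J
      simp [Polynomial.coe_aeval_eq_eval, Polynomial.eval_finsetSum, hdet, pluckerVector]
    exact DFunLike.congr_fun this f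
  have hzero : P * ∏ i, ((M i).submatrix id (S i)).det = 0 := by
    refine Polynomial.funext fun t => ?_
    rw [Polynomial.eval_mul, Polynomial.eval_zero]
    by_cases h : ∀ i, ((M i).submatrix id (S i)).det.eval t ≠ 0
    · obtain ⟨u, hu⟩ := exists_secantCoord_eq S c (fun i => A i + t • E i)
        fun i => by rw [← hdet]; exact h i
      have : (∑ i, c i • pluckerVector (A i + t • E i)) =
          fun J : PluckerIndex k n => secantCoord S u J := by
        ext J
        simp [hu, pluckerVector]
      rw [hPeval, this, ← eval_secantComorphism, hf, map_zero, zero_mul]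
    · push Not at h
      obtain ⟨i, hi⟩ := h
      rw [Polynomial.eval_prod, Finset.prod_eq_zero (Finset.mem_univ i) hi, mul_zero]
  have hP0 : P = 0 := (mul_eq_zero.1 hzero).resolve_right
    (Finset.prod_ne_zero_iff.2 fun i _ => hD i)
  have := hPeval 0
  simpa [hP0] using this.symm

theorem homogeneousIdeal_spanUnion_grassmannian [Infinite K] (hs : 0 < s)
    (S : Fin s → PluckerIndex k n) :
    homogeneousIdeal (spanUnion s (grassmannian K k n)) = RingHom.ker (secantComorphism K S) := by
  ext f
  rw [mem_homogeneousIdeal_iff, RingHom.mem_ker, affineCone_spanUnion hs]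
  constructor
  · intro h
    refine MvPolynomial.funext fun u => ?_
    rw [map_zero, eval_secantComorphism]
    refine h _ ⟨fun i => u ⟨i, none⟩ • pluckerVector (chartMatrix (S i) (chartEntries S u i)),
      fun i => smul_pluckerVector_mem_affineCone (fun h0 => ?_) _, ?_⟩
    · have := congrFun h0 (S i)
      simp [pluckerVector, chartMatrix_submatrix_self] at this
    · ext J
      simp [secantCoord, pluckerVector]
  · rintro h v ⟨w, hw, rfl⟩
    choose c A hA using fun i => exists_eq_smul_pluckerVector (hw i)
    simp_rw [hA]
    exact eval_sum_pluckerVector_eq_zero S c A h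

end SecantIdeal

section LowerBound

variable {k n s : ℕ}

theorem two_le_offCount_update {S T : PluckerIndex k n} (h : 3 ≤ offCount T S) (a : Fin (k + 1))
    (b : Fin (n + 1)) : 2 ≤ offCount T (Function.update S a b) := by
  have hsub : (Finset.univ.filter fun p => S p ∉ Set.range T).erase a ⊆
      Finset.univ.filter fun p => Function.update S a b p ∉ Set.range T := by
    intro p hp
    rw [Finset.mem_erase, Finset.mem_filter] at hp
    rw [Finset.mem_filter, Function.update_of_ne hp.1]
    exact hp.2
  have h1 := Finset.card_le_card hsub
  have h2 := Finset.pred_card_le_card_erase (s := Finset.univ.filter fun p => S p ∉ Set.range T)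
    (a := a)
  unfold offCount at *
  omega

/-- The columns of the Plücker coordinate whose first-order term at the base point of the chart is
the given parameter. -/
def tangentColumns (S : Fin s → PluckerIndex k n) : ChartIndex S → Fin (k + 1) → Fin (n + 1)
  | ⟨i, none⟩ => S i
  | ⟨i, some (a, b)⟩ => Function.update (S i) a b

theorem tangentColumns_injective (S : Fin s → PluckerIndex k n) (x : ChartIndex S) :
    Function.Injective (tangentColumns S x) := by
  obtain ⟨i, _ | ⟨a, b⟩⟩ := x
  · exact (S i).injective
  · intro p q hpq
    have hne : ∀ c, S i c ≠ b := fun c hc => b.2 ⟨c, hc⟩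
    simp only [tangentColumns, Function.update_apply] at hpq
    split_ifs at hpq with h1 h2 h2
    · rw [h1, h2]
    · exact absurd hpq.symm (hne q)
    · exact absurd hpq (hne p)
    · exact (S i).injective hpq

theorem two_le_offCount_tangentColumns {S : Fin s → PluckerIndex k n}
    (hS : ∀ i j, i ≠ j → 3 ≤ offCount (S j) (S i)) (x : ChartIndex S) {j : Fin s}
    (hj : j ≠ x.1) : 2 ≤ offCount (S j) (tangentColumns S x) := by
  obtain ⟨i, _ | ⟨a, b⟩⟩ := x
  · exact le_trans (by norm_num) (hS i j hj.symm)
  · exact two_le_offCount_update (hS i j hj.symm) a b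

variable {K : Type*} [Field K]

/-- A line through the base point of the charts in the direction of the generic parameter. -/
noncomputable def genericLine (K : Type*) [Field K] (S : Fin s → PluckerIndex k n) :
    ChartIndex S → Polynomial (MvPolynomial (ChartIndex S) K)
  | ⟨i, none⟩ => 1 + Polynomial.X * Polynomial.C (X ⟨i, none⟩)
  | ⟨i, some p⟩ => Polynomial.X * Polynomial.C (X ⟨i, some p⟩)

theorem chartEntries_genericLine (S : Fin s → PluckerIndex k n) (i : Fin s) :
    chartEntries S (genericLine K S) i =
      (Polynomial.X : Polynomial (MvPolynomial (ChartIndex S) K)) •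
        chartEntries S (fun x => Polynomial.C (X x : MvPolynomial (ChartIndex S) K)) i := by
  ext a b : 2
  simp only [chartEntries, Pi.smul_apply, smul_eq_mul]
  split_ifs <;> simp [genericLine]

theorem exists_secantCoord_genericLine {S : Fin s → PluckerIndex k n}
    (hS : ∀ i j, i ≠ j → 3 ≤ offCount (S j) (S i)) (x : ChartIndex S) :
    ∃ (c : K) (g : Polynomial (MvPolynomial (ChartIndex S) K)), g.eval 0 = X x ∧
      secantCoord S (genericLine K S) (tangentColumns S x) =
        algebraMap K (Polynomial (MvPolynomial (ChartIndex S) K)) c + Polynomial.X * g := by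
  have hoff : Polynomial.X ^ 2 ∣ ∑ j ∈ Finset.univ.erase x.1, genericLine K S ⟨j, none⟩ *
      ((chartMatrix (S j) (chartEntries S (genericLine K S) j)).submatrix id
        (tangentColumns S x)).det := by
    refine Finset.dvd_sum fun j hj => ?_
    rw [chartEntries_genericLine, det_chartMatrix_smul_submatrix]
    exact Dvd.dvd.mul_left (Dvd.dvd.mul_right
      (pow_dvd_pow _ (two_le_offCount_tangentColumns hS x (Finset.ne_of_mem_erase hj))) _) _
  obtain ⟨H, hH⟩ := hoff
  rw [secantCoord, ← Finset.add_sum_erase _ _ (Finset.mem_univ x.1), hH]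
  obtain ⟨i, _ | ⟨a, b⟩⟩ := x
  · refine ⟨1, Polynomial.C (X ⟨i, none⟩) + Polynomial.X * H, by simp, ?_⟩
    simp only [tangentColumns, chartMatrix_submatrix_self, Matrix.det_one, genericLine, map_one]
    ring
  · refine ⟨0, Polynomial.C (X ⟨i, some (a, b)⟩) * genericLine K S ⟨i, none⟩ + Polynomial.X * H,
      by simp [genericLine], ?_⟩
    simp only [tangentColumns, det_chartMatrix_submatrix_update _ _ _ b.2, map_zero]
    rw [chartEntries, dif_neg b.2]
    simp only [genericLine]
    ring

theorem algebraicIndependent_secantCoord {S : Fin s → PluckerIndex k n}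
    (hS : ∀ i j, i ≠ j → 3 ≤ offCount (S j) (S i)) :
    AlgebraicIndependent K fun x : ChartIndex S =>
      secantCoord S (X : ChartIndex S → MvPolynomial (ChartIndex S) K) (tangentColumns S x) := by
  choose c g hg hc using exists_secantCoord_genericLine (K := K) hS
  refine AlgebraicIndependent.of_comp (aeval (genericLine K S)) ?_
  have := algebraicIndependent_C_add_X_mul c g
    (by simpa only [hg] using MvPolynomial.algebraicIndependent_X _ _)
  convert this using 2 with x
  rw [← hc]
  exact (map_secantCoord (aeval (genericLine K S) : MvPolynomial (ChartIndex S) K →ₐ[K]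
    Polynomial (MvPolynomial (ChartIndex S) K)).toRingHom S X _).trans (by simp)

theorem exists_eq_comp_perm {f : Fin (k + 1) → Fin (n + 1)} (hf : Function.Injective f) :
    ∃ (J : PluckerIndex k n) (σ : Equiv.Perm (Fin (k + 1))), f = J ∘ σ := by
  refine ⟨OrderEmbedding.ofStrictMono (f ∘ Tuple.sort f)
    ((Tuple.monotone_sort f).strictMono_of_injective (hf.comp (Tuple.sort f).injective)),
    (Tuple.sort f)⁻¹, ?_⟩
  ext p
  simp

theorem secantCoord_comp_perm {R : Type*} [CommRing R] (S : Fin s → PluckerIndex k n)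
    (u : ChartIndex S → R) (f : Fin (k + 1) → Fin (n + 1)) (σ : Equiv.Perm (Fin (k + 1))) :
    secantCoord S u (f ∘ σ) = (Equiv.Perm.sign σ : ℤ) • secantCoord S u f := by
  rw [secantCoord, secantCoord, Finset.smul_sum]
  refine Finset.sum_congr rfl fun i _ => ?_
  have := Matrix.det_permute' σ ((chartMatrix (S i) (chartEntries S u i)).submatrix id f)
  rw [Matrix.submatrix_submatrix, Function.id_comp] at this
  rw [this, zsmul_eq_mul]
  ring

theorem secantCoord_mem_range (S : Fin s → PluckerIndex k n) {f : Fin (k + 1) → Fin (n + 1)}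
    (hf : Function.Injective f) :
    secantCoord S (X : ChartIndex S → MvPolynomial (ChartIndex S) K) f ∈
      (secantComorphism K S).range := by
  obtain ⟨J, σ, rfl⟩ := exists_eq_comp_perm hf
  rw [secantCoord_comp_perm]
  have hJ : secantCoord S (X : ChartIndex S → MvPolynomial (ChartIndex S) K) J ∈
      (secantComorphism K S).range := ⟨X J, by simp [secantComorphism]⟩
  exact zsmul_mem hJ _

theorem card_chartIndex (S : Fin s → PluckerIndex k n) :
    Nat.card (ChartIndex S) = s * ((k + 1) * (n - k) + 1) := by
  have h (i : Fin s) : Fintype.card {b : Fin (n + 1) // b ∉ Set.range (S i)} = n - k := by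
    rw [Fintype.card_subtype_compl,
      ← Fintype.card_congr (Equiv.ofInjective (S i) (S i).injective)]
    simp
  simp only [Nat.card_eq_fintype_card, Fintype.card_sigma, Fintype.card_option, Fintype.card_prod,
    h, Fintype.card_fin, Finset.sum_const, Finset.card_univ, smul_eq_mul]

theorem ringKrullDim_spanUnion_grassmannian [Infinite K] (hs : 0 < s)
    {S : Fin s → PluckerIndex k n} (hS : ∀ i j, i ≠ j → 3 ≤ offCount (S j) (S i)) :
    ringKrullDim (HomogeneousCoordinateRing (spanUnion s (grassmannian K k n))) =
      ((s * ((k + 1) * (n - k) + 1) : ℕ) : WithBot ℕ∞) := by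
  have e : HomogeneousCoordinateRing (spanUnion s (grassmannian K k n)) ≃+*
      (secantComorphism K S).range :=
    (Ideal.quotEquivOfEq (homogeneousIdeal_spanUnion_grassmannian hs S)).trans
      (RingHom.quotientKerEquivRange (secantComorphism K S).toRingHom)
  have hfin : Algebra.FiniteType K (secantComorphism K S).range :=
    Algebra.FiniteType.of_surjective (secantComorphism K S).rangeRestrict
      (secantComorphism K S).rangeRestrict_surjective
  rw [ringKrullDim_eq_of_ringEquiv e, ← card_chartIndex S]
  refine ringKrullDim_eq_card_of_algebraicIndependent (secantComorphism K S).range.val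
    Subtype.val_injective (fun x => ⟨_, secantCoord_mem_range S (tangentColumns_injective S x)⟩) ?_
  exact AlgebraicIndependent.of_comp (secantComorphism K S).range.val
    (algebraicIndependent_secantCoord hS)

/-- The window `m, …, m + k` of consecutive indices. -/
def window (m : ℕ) (hm : m + k ≤ n) : PluckerIndex k n :=
  OrderEmbedding.ofStrictMono (fun a => ⟨m + a, by omega⟩) fun _ _ h =>
    Nat.add_lt_add_left h m

theorem three_le_offCount_window (hk : 2 ≤ k) {m m' : ℕ} (hm : m + k ≤ n) (hm' : m' + k ≤ n)
    (h : m + 3 ≤ m' ∨ m' + 3 ≤ m) : 3 ≤ offCount (window m' hm') (window m hm) := by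
  have key : ∀ a : Fin (k + 1), window m hm a ∉ Set.range (window m' hm') ↔
      m + a < m' ∨ m' + k < m + a := by
    intro a
    constructor
    · intro ha
      by_contra! hcon
      refine ha ⟨⟨m + a - m', by omega⟩, ?_⟩
      refine Fin.ext ?_
      change m' + (m + a - m') = m + a
      omega
    · rintro ha ⟨c, hc⟩
      have := congrArg Fin.val hc
      change m' + c = m + a at this
      omega
  have hmem : ∀ a : Fin (k + 1), m + a < m' ∨ m' + k < m + a →
      a ∈ Finset.univ.filter fun p => window m hm p ∉ Set.range (window m' hm') := fun a ha =>
    Finset.mem_filter.2 ⟨Finset.mem_univ _, (key a).2 ha⟩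
  rw [offCount, Nat.succ_le_iff, Finset.two_lt_card]
  rcases h with h | h
  · refine ⟨⟨0, by omega⟩, hmem _ ?_, ⟨1, by omega⟩, hmem _ ?_, ⟨2, by omega⟩, hmem _ ?_, ?_⟩ <;>
      simp only [ne_eq, Fin.mk.injEq] <;> omega
  · refine ⟨⟨k, by omega⟩, hmem _ ?_, ⟨k - 1, by omega⟩, hmem _ ?_, ⟨k - 2, by omega⟩,
      hmem _ ?_, ?_⟩ <;> simp only [ne_eq, Fin.mk.injEq] <;> omega

theorem ringKrullDim_secant_grassmannian [Infinite K] (hk : 2 ≤ k) (hkn : k ≤ n) (hs : 1 ≤ s)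
    (hsn : 3 * (s - 1) ≤ n - k) :
    ringKrullDim (HomogeneousCoordinateRing (spanUnion s (grassmannian K k n))) =
      ((s * ((k + 1) * (n - k) + 1) : ℕ) : WithBot ℕ∞) := by
  refine ringKrullDim_spanUnion_grassmannian hs
    (S := fun i => window (3 * i) (by omega)) fun i j hij => ?_
  refine three_le_offCount_window hk _ _ ?_
  have := Fin.val_ne_of_ne hij
  omega

end LowerBound

end SecantGrassmannian

theorem mainTheorem6 {K : Type*} [Field K] [Infinite K] (hchar : ringChar K ≠ 2)
    (k n s : ℕ) (hk : 2 ≤ k) (hkn : k ≤ n) (hs : 1 ≤ s) (hsn : 3 * (s - 1) ≤ n - k) :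
    SecantGrassmannian.HasDimension
        (SecantGrassmannian.secantVariety s (SecantGrassmannian.grassmannian K k n))
        (s * ((k + 1) * (n - k) + 1) - 1) ∧
      SecantGrassmannian.HasExpectedDimension s (SecantGrassmannian.grassmannian K k n) := by
  have hdim := SecantGrassmannian.ringKrullDim_secant_grassmannian (K := K) hk hkn hs hsn
  have hpos : 1 ≤ s * ((k + 1) * (n - k) + 1) := Nat.mul_pos hs (Nat.succ_pos _)
  have hsec : SecantGrassmannian.HasDimension
      (SecantGrassmannian.secantVariety s (SecantGrassmannian.grassmannian K k n))
      (s * ((k + 1) * (n - k) + 1) - 1) := by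
    rw [SecantGrassmannian.HasDimension, Nat.sub_add_cancel hpos, ← hdim]
    exact ringKrullDim_eq_of_ringEquiv
      (Ideal.quotEquivOfEq (SecantGrassmannian.homogeneousIdeal_zariskiClosure _))
  refine ⟨hsec, (k + 1) * (n - k), ?_, ?_⟩
  · have h1 := SecantGrassmannian.ringKrullDim_secant_grassmannian (K := K) (s := 1) hk hkn le_rfl
      (by simp)
    rwa [SecantGrassmannian.spanUnion_one, one_mul] at h1
  · have hle : s * ((k + 1) * (n - k) + 1) ≤
        Fintype.card (SecantGrassmannian.PluckerIndex k n) := by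
      have h1 := ringKrullDim_quotient_le (SecantGrassmannian.homogeneousIdeal
        (SecantGrassmannian.spanUnion s (SecantGrassmannian.grassmannian K k n)))
      rw [hdim, MvPolynomial.ringKrullDim_of_isNoetherianRing, ringKrullDim_eq_zero_of_field,
        zero_add, Nat.card_eq_fintype_card] at h1
      exact_mod_cast h1
    rwa [min_eq_left (Nat.sub_le_sub_right hle 1)]
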